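/- For an integer $n\ge 1$ and a real number $\xi$, let $\lambda_n(\xi)\in[-\infty,+\infty]$ be the supremum of the real numbers $\lambda$ such that, for arbitrarily large real numbers $X$, the inequalities $$0<|x_0|\le X,\qquad \max_{1\le m\le n}|x_0\xi^m-x_m|\le X^{-\lambda}$$ have a solution in integers $x_0,\dots,x_n$. The spectrum of $\lambda_n$ is the set of values taken by $\lambda_n$ on the set of transcendental real numbers. **Theorem.** For every integer $n\ge 1$, the spectrum of $\lambda_n$ includes the interval $$\left(\frac{3+\sqrt{4n^2+1}}{2n},\,+\infty\right],$$ that is, for every $\lambda$ in this interval (the value $+\infty$ included) there is a transcendental real number $\xi$ with $\lambda_n(\xi)=\lambda$. -/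

import Mathlib

noncomputable section

namespace SimultApprox

/-- `x = (x_0, …, x_n)` solves `0 < |x_0| ≤ X` and `max_{1 ≤ m ≤ n} |x_0 ξ^m - x_m| ≤ X^(-l)`. -/
def IsSolution (n : ℕ) (ξ l X : ℝ) (x : Fin (n + 1) → ℤ) : Prop :=
  0 < |(x 0 : ℝ)| ∧ |(x 0 : ℝ)| ≤ X ∧
    ∀ m : Fin n, |(x 0 : ℝ) * ξ ^ ((m : ℕ) + 1) - (x m.succ : ℝ)| ≤ X ^ (-l)

/-- The exponent `λ_n(ξ)`: the supremum, in the extended reals, of the real numbers `l` such that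
for arbitrarily large real `X` the system above has an integer solution. -/
def lambdaExp (n : ℕ) (ξ : ℝ) : EReal :=
  sSup {L : EReal | ∃ l : ℝ, L = (l : EReal) ∧
    ∀ X₀ : ℝ, ∃ X : ℝ, X₀ ≤ X ∧ ∃ x : Fin (n + 1) → ℤ, IsSolution n ξ l X x}

/-- The spectrum of `λ_n`: the set of its values at transcendental real numbers. -/
def lambdaSpectrum (n : ℕ) : Set EReal :=
  {L : EReal | ∃ ξ : ℝ, Transcendental ℚ ξ ∧ lambdaExp n ξ = L}

end SimultApprox

end

/-!
For `l ≥ 1` the condition `λ_n(ξ) = l` is a condition on rational approximation to `ξ` alone: a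
rational `r = p / q` with `|ξ - r| ≤ q ^ (-n (l + 1))` gives the solution
`q ^ n • (1, r, …, r ^ n)`, and conversely a solution `x` of high quality must be of this shape up
to a factor, because the integers `x_m` and the numbers `x_0 (x_1 / x_0) ^ m` are too close to
differ, which forces `q ^ n ∣ x_0` for the denominator `q` of `x_1 / x_0`.

Liouville numbers give `λ_n(ξ) = ∞`, and it remains to find transcendental numbers of every
irrationality exponent `c ≥ 2`. We take limits of sequences `r_0 < r_1 < ⋯` of rationals with
denominators `q_k` such that `r_{k + 1} - r_k = 1 / (q_k q_{k + 1})` and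
`q_{k + 1} ≍ q_k ^ (c - 1)`. At each step there are two choices of `r_{k + 1}` leading to disjoint
sets of possible limits, so that one of them avoids the `k`-th element of any prescribed countable
set, such as the set of algebraic numbers.
-/

open Filter Set

namespace SimultApprox

section RationalApproximation

/-- The irrationality exponent of `x` is `μ`: the supremum of the orders `p` to which `x` is
approximable by rational numbers, in the sense of `LiouvilleWith p x`. -/
def HasIrrationalityExponent (x μ : ℝ) : Prop := IsLUB {p | LiouvilleWith p x} μ

lemma one_le_den (r : ℚ) : (1 : ℝ) ≤ r.den := by exact_mod_cast r.pos

lemma den_pos (r : ℚ) : (0 : ℝ) < r.den := by exact_mod_cast r.pos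

lemma one_div_den_mul_den_le_abs_sub {a b : ℚ} (h : a ≠ b) :
    1 / (a.den * b.den : ℚ) ≤ |a - b| := by
  have ha : (0 : ℚ) < a.den := by exact_mod_cast a.pos
  have hb : (0 : ℚ) < b.den := by exact_mod_cast b.pos
  have hsub : a - b = ((a.num * b.den - a.den * b.num : ℤ) : ℚ) / (a.den * b.den) := by
    conv_lhs => rw [← Rat.num_div_den a, ← Rat.num_div_den b, div_sub_div _ _ ha.ne' hb.ne']
    push_cast
    rfl
  have hnum : a.num * b.den - a.den * b.num ≠ 0 := fun h0 => by
    rw [h0, Int.cast_zero, zero_div] at hsub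
    exact h (sub_eq_zero.1 hsub)
  rw [hsub, abs_div, abs_of_pos (mul_pos ha hb)]
  gcongr
  exact_mod_cast Int.one_le_abs hnum

lemma liouvilleWith_of_forall_exists_rat {p x C : ℝ}
    (h : ∀ Q : ℕ, ∃ r : ℚ, Q ≤ r.den ∧ x ≠ r ∧ |x - r| < C / (r.den : ℝ) ^ p) :
    LiouvilleWith p x := by
  refine ⟨C, frequently_atTop.2 fun Q => ?_⟩
  obtain ⟨r, hQ, hr⟩ := h Q
  exact ⟨r.den, hQ, r.num, by rwa [← Rat.cast_def]⟩

lemma not_liouvilleWith_of_forall_div_rpow_le {x c s δ : ℝ} (hc : 0 ≤ c) (hδ : 0 < δ)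
    (h : ∀ r : ℚ, δ / (r.den : ℝ) ^ c ≤ |x - r|) (hs : c < s) : ¬LiouvilleWith s x := by
  rintro ⟨C, hC⟩
  have hlarge : ∀ᶠ q : ℕ in atTop, C / δ ≤ (q : ℝ) ^ (s - c) :=
    ((tendsto_rpow_atTop (sub_pos.2 hs)).comp tendsto_natCast_atTop_atTop).eventually_ge_atTop _
  obtain ⟨q, ⟨m, -, hm⟩, hq, hq0⟩ := (hC.and_eventually (hlarge.and (eventually_gt_atTop 0))).exists
  have hqR : (0 : ℝ) < q := by exact_mod_cast hq0
  have hden : ((m / q : ℚ).den : ℝ) ≤ q := by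
    have hdvd := Rat.den_dvd m q
    rw [Rat.divInt_eq_div, Int.cast_natCast] at hdvd
    exact_mod_cast Nat.le_of_dvd hq0 (Int.natCast_dvd_natCast.1 hdvd)
  have hlow : δ / (q : ℝ) ^ c ≤ |x - m / q| := by
    have hr := h (m / q)
    push_cast at hr
    refine le_trans ?_ hr
    gcongr
  have hlt : δ / (q : ℝ) ^ c < C / (q : ℝ) ^ s := hlow.trans_lt hm
  rw [div_lt_div_iff₀ (by positivity) (by positivity)] at hlt
  rw [div_le_iff₀ hδ, Real.rpow_sub hqR, div_mul_eq_mul_div, le_div_iff₀ (by positivity)] at hq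
  linarith

end RationalApproximation

section Exponent

/-- `l` is one of the exponents whose supremum is `λ_n(ξ)`. -/
def IsAdmissible (n : ℕ) (ξ l : ℝ) : Prop :=
  ∃ᶠ X : ℝ in atTop, ∃ x : Fin (n + 1) → ℤ, IsSolution n ξ l X x

variable {n : ℕ} {ξ l : ℝ}

lemma lambdaExp_eq_sSup (n : ℕ) (ξ : ℝ) :
    lambdaExp n ξ = sSup ((fun l : ℝ => (l : EReal)) '' {l | IsAdmissible n ξ l}) := by
  refine congrArg sSup (Set.ext fun L => ?_)
  simp only [mem_ofPred_eq, mem_image, IsAdmissible, frequently_atTop]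
  exact exists_congr fun l => ⟨fun h => ⟨h.2, h.1.symm⟩, fun h => ⟨h.2.symm, h.1⟩⟩

lemma IsAdmissible.coe_le_lambdaExp (h : IsAdmissible n ξ l) : (l : EReal) ≤ lambdaExp n ξ := by
  rw [lambdaExp_eq_sSup]
  exact le_sSup (mem_image_of_mem _ h)

lemma exists_abs_pow_sub_pow_le (n : ℕ) (x : ℝ) :
    ∃ C, 0 ≤ C ∧ ∀ m ≤ n, ∀ y, |x - y| ≤ 1 → |x ^ m - y ^ m| ≤ C * |x - y| := by
  refine ⟨n * (|x| + 1) ^ n, by positivity, fun m hm y hxy => ?_⟩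
  have hy : |y| ≤ |x| + 1 := by linarith [abs_sub_abs_le_abs_sub y x, abs_sub_comm x y]
  have hmax : max |x| |y| ≤ |x| + 1 := max_le (by linarith) hy
  have hone : 1 ≤ |x| + 1 := by linarith [abs_nonneg x]
  calc |x ^ m - y ^ m| ≤ |x - y| * m * max |x| |y| ^ (m - 1) := abs_pow_sub_pow_le ..
    _ ≤ |x - y| * n * (|x| + 1) ^ n := by
      gcongr
      exact (pow_le_pow_left₀ (by positivity) hmax _).trans (pow_le_pow_right₀ hone (by omega))
    _ = n * (|x| + 1) ^ n * |x - y| := by ring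

lemma isSolution_pow_mul_pow {q : ℕ} (hq : 0 < q) (p : ℤ)
    (h : ∀ m ≤ n, (q : ℝ) ^ n * |ξ ^ m - (p / q) ^ m| ≤ ((q : ℝ) ^ n) ^ (-l)) :
    IsSolution n ξ l ((q : ℝ) ^ n) fun m => (q : ℤ) ^ (n - m) * p ^ (m : ℕ) := by
  have hzero : (((q : ℤ) ^ (n - (0 : Fin (n + 1))) * p ^ ((0 : Fin (n + 1)) : ℕ) : ℤ) : ℝ) =
      (q : ℝ) ^ n := by simp
  have habs : |(q : ℝ) ^ n| = (q : ℝ) ^ n := abs_of_pos (by positivity)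
  refine ⟨?_, ?_, fun m => ?_⟩
  · rw [hzero, habs]
    positivity
  · rw [hzero, habs]
  · have hm : (m : ℕ) + 1 ≤ n := m.2
    have hcoord : (((q : ℤ) ^ (n - (m.succ : ℕ)) * p ^ (m.succ : ℕ) : ℤ) : ℝ) =
        (q : ℝ) ^ n * (p / q) ^ ((m : ℕ) + 1) := by
      have hsplit : (q : ℝ) ^ n = q ^ (n - ((m : ℕ) + 1)) * q ^ ((m : ℕ) + 1) := by
        rw [← pow_add, Nat.sub_add_cancel hm]
      rw [Fin.val_succ, div_pow, hsplit]
      push_cast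
      field_simp
    rw [hzero, hcoord, ← mul_sub, abs_mul, habs]
    exact h _ hm

lemma isAdmissible_of_liouvilleWith {p : ℝ} (hn : 1 ≤ n) (hp : 0 < p) (hl : n * (l + 1) < p)
    (h : LiouvilleWith p ξ) : IsAdmissible n ξ l := by
  obtain ⟨C, hC⟩ := h
  obtain ⟨D, hD, hpow⟩ := exists_abs_pow_sub_pow_le n ξ
  have hlarge : ∀ᶠ q : ℕ in atTop, C ≤ (q : ℝ) ^ p ∧ D * C ≤ (q : ℝ) ^ (p - n * (l + 1)) :=
    tendsto_natCast_atTop_atTop.eventually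
      (((tendsto_rpow_atTop hp).eventually_ge_atTop C).and
        ((tendsto_rpow_atTop (sub_pos.2 hl)).eventually_ge_atTop (D * C)))
  have hsol : ∃ᶠ q : ℕ in atTop, ∃ x, IsSolution n ξ l ((q : ℝ) ^ n) x := by
    refine (hC.and_eventually (hlarge.and (eventually_gt_atTop 0))).mono ?_
    rintro q ⟨⟨a, -, ha⟩, ⟨hCq, hDq⟩, hq⟩
    have hqR : (0 : ℝ) < q := by exact_mod_cast hq
    have hdist : |ξ - a / q| ≤ 1 := ha.le.trans (div_le_one_of_le₀ hCq (by positivity))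
    refine ⟨_, isSolution_pow_mul_pow hq a fun m hm => ?_⟩
    calc (q : ℝ) ^ n * |ξ ^ m - (a / q) ^ m|
        ≤ (q : ℝ) ^ n * (D * (C / (q : ℝ) ^ p)) := by
          gcongr
          exact (hpow m hm _ hdist).trans (by gcongr)
      _ = D * C * ((q : ℝ) ^ n / (q : ℝ) ^ p) := by ring
      _ ≤ (q : ℝ) ^ (p - n * (l + 1)) * ((q : ℝ) ^ n / (q : ℝ) ^ p) := by gcongr
      _ = ((q : ℝ) ^ n) ^ (-l) := by
          rw [← Real.rpow_natCast, ← Real.rpow_sub hqR, ← Real.rpow_add hqR,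
            ← Real.rpow_mul hqR.le]
          congr 1
          ring
  exact ((tendsto_pow_atTop (by omega)).comp tendsto_natCast_atTop_atTop).frequently hsol

lemma den_pow_succ_dvd {r : ℚ} {a b : ℤ} {m : ℕ} (ha : (r.den : ℤ) ^ m ∣ a)
    (hb : r.den * |a * r ^ (m + 1) - b| < 1) : (r.den : ℤ) ^ (m + 1) ∣ a := by
  obtain ⟨u, rfl⟩ := ha
  have hden : (r.den : ℚ) ≠ 0 := by exact_mod_cast r.den_nz
  have hint : (r.den : ℚ) * (((r.den : ℤ) ^ m * u : ℤ) * r ^ (m + 1) - b) =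
      ((u * r.num ^ (m + 1) - r.den * b : ℤ) : ℚ) := by
    have hr : r ^ (m + 1) = r.num ^ (m + 1) / r.den ^ (m + 1) := by
      rw [← div_pow, Rat.num_div_den]
    rw [hr]
    push_cast
    field_simp
    ring
  have hzero : u * r.num ^ (m + 1) - r.den * b = 0 := by
    rw [← Int.abs_lt_one_iff]
    rw [← Nat.abs_cast r.den, ← abs_mul, hint] at hb
    exact_mod_cast hb
  have hdvd : (r.den : ℤ) ∣ u * r.num ^ (m + 1) := ⟨b, sub_eq_zero.1 hzero⟩
  rw [pow_succ]
  exact mul_dvd_mul_left _ (r.isCoprime_num_den.symm.pow_right.dvd_of_dvd_mul_right hdvd)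

lemma den_pow_dvd {r : ℚ} {a : ℤ} {b : Fin n → ℤ}
    (hb : ∀ m : Fin n, r.den * |a * r ^ ((m : ℕ) + 1) - b m| < 1) : (r.den : ℤ) ^ n ∣ a := by
  induction n with
  | zero => simp
  | succ n ih => exact den_pow_succ_dvd (ih fun m => hb m.castSucc) (hb (Fin.last n))

lemma abs_mul_sub_le {a b y z C ε δ : ℝ} (hC : 0 ≤ C) (hyb : |a * y - b| ≤ ε)
    (hyz : |y - z| ≤ C * δ) (hδ : |a| * δ ≤ ε) : |a * z - b| ≤ (C + 1) * ε := by
  have hdiff : |a * (z - y)| ≤ C * ε := by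
    rw [abs_mul, abs_sub_comm]
    calc |a| * |y - z| ≤ |a| * (C * δ) := by gcongr
      _ = C * (|a| * δ) := by ring
      _ ≤ C * ε := by gcongr
  calc |a * z - b| = |a * (z - y) + (a * y - b)| := by ring_nf
    _ ≤ |a * (z - y)| + |a * y - b| := abs_add_le _ _
    _ ≤ (C + 1) * ε := by linarith

lemma IsSolution.apply_zero_ne_zero {X : ℝ} {x : Fin (n + 1) → ℤ} (hx : IsSolution n ξ l X x) :
    x 0 ≠ 0 := by
  simpa using hx.1

lemma IsSolution.natCast_le_abs {X : ℝ} {x : Fin (n + 1) → ℤ} (hx : IsSolution n ξ l X x)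
    {d : ℕ} (hd : (d : ℤ) ∣ x 0) : (d : ℝ) ≤ |(x 0 : ℝ)| := by
  exact_mod_cast Int.le_of_dvd (abs_pos.2 hx.apply_zero_ne_zero) ((dvd_abs _ _).2 hd)

lemma IsSolution.one_le_abs {X : ℝ} {x : Fin (n + 1) → ℤ} (hx : IsSolution n ξ l X x) :
    1 ≤ |(x 0 : ℝ)| := by
  exact_mod_cast Int.one_le_abs hx.apply_zero_ne_zero

lemma IsSolution.abs_mul_abs_sub_le (hn : 0 < n) {X : ℝ} {x : Fin (n + 1) → ℤ}
    (hx : IsSolution n ξ l X x) :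
    |(x 0 : ℝ)| * |ξ - ((x (Fin.succ ⟨0, hn⟩) / x 0 : ℚ) : ℝ)| ≤ X ^ (-l) := by
  have hx0 : (x 0 : ℝ) ≠ 0 := by exact_mod_cast hx.apply_zero_ne_zero
  have h := hx.2.2 ⟨0, hn⟩
  rw [zero_add, pow_one] at h
  rw [← abs_mul, mul_sub]
  push_cast
  rwa [mul_div_cancel₀ _ hx0]

lemma eventually_den_pow_dvd_of_isSolution (hn : 0 < n) (ξ : ℝ) (hl : 1 < l) :
    ∀ᶠ X : ℝ in atTop, ∀ x, IsSolution n ξ l X x →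
      (((x (Fin.succ ⟨0, hn⟩) / x 0 : ℚ).den : ℤ)) ^ n ∣ x 0 := by
  obtain ⟨D, hD, hpow⟩ := exists_abs_pow_sub_pow_le n ξ
  have hlim := (tendsto_rpow_neg_atTop (sub_pos.2 hl)).const_mul (D + 1)
  rw [mul_zero] at hlim
  filter_upwards [hlim.eventually_lt_const one_pos, eventually_ge_atTop 1] with X hX hX1 x hx
  set r : ℚ := x (Fin.succ ⟨0, hn⟩) / x 0 with hr
  have hXpos : 0 < X := by linarith
  have hdist : |(x 0 : ℝ)| * |ξ - r| ≤ X ^ (-l) := hx.abs_mul_abs_sub_le hn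
  have hdist_one : |ξ - r| ≤ 1 :=
    (le_mul_of_one_le_left (abs_nonneg _) hx.one_le_abs).trans
      (hdist.trans (Real.rpow_le_one_of_one_le_of_nonpos hX1 (by linarith)))
  have hden : (r.den : ℝ) ≤ X := by
    have hdvd := Rat.den_dvd (x (Fin.succ ⟨0, hn⟩)) (x 0)
    rw [Rat.divInt_eq_div, ← hr] at hdvd
    exact (hx.natCast_le_abs hdvd).trans hx.2.1
  refine den_pow_dvd (b := fun m => x m.succ) fun m => ?_
  have hclose : |(x 0 : ℝ) * r ^ ((m : ℕ) + 1) - x m.succ| ≤ (D + 1) * X ^ (-l) :=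
    abs_mul_sub_le hD (hx.2.2 m) (hpow _ m.2 r hdist_one) hdist
  have hlt : (r.den : ℝ) * |(x 0 : ℝ) * r ^ ((m : ℕ) + 1) - x m.succ| < 1 :=
    calc (r.den : ℝ) * |(x 0 : ℝ) * r ^ ((m : ℕ) + 1) - x m.succ|
        ≤ X * ((D + 1) * X ^ (-l)) := by gcongr
      _ = (D + 1) * X ^ (-(l - 1)) := by
        rw [mul_left_comm, ← Real.rpow_one_add' hXpos.le (by linarith)]
        ring_nf
      _ < 1 := hX
  exact_mod_cast hlt

lemma eventually_exists_rat_of_isSolution (hn : 1 ≤ n) (ξ : ℝ) (hl : 1 < l) :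
    ∀ᶠ X : ℝ in atTop, ∀ x, IsSolution n ξ l X x →
      ∃ r : ℚ, |ξ - r| ≤ X ^ (-l) ∧ |ξ - r| ≤ (r.den : ℝ) ^ (-(n * (l + 1))) := by
  filter_upwards [eventually_den_pow_dvd_of_isSolution hn ξ hl] with X hdvd x hx
  specialize hdvd x hx
  set r : ℚ := x (Fin.succ ⟨0, hn⟩) / x 0
  have hx0 : 0 < |(x 0 : ℝ)| := hx.1
  have hdist : |(x 0 : ℝ)| * |ξ - r| ≤ X ^ (-l) := hx.abs_mul_abs_sub_le hn
  have hrden := den_pos r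
  have hden : (r.den : ℝ) ^ n ≤ |(x 0 : ℝ)| := by
    rw [← Nat.cast_pow] at hdvd ⊢
    exact hx.natCast_le_abs hdvd
  refine ⟨r, (le_mul_of_one_le_left (abs_nonneg _) hx.one_le_abs).trans hdist, ?_⟩
  calc |ξ - r| ≤ |(x 0 : ℝ)|⁻¹ * X ^ (-l) := (le_inv_mul_iff₀ hx0).2 hdist
    _ ≤ |(x 0 : ℝ)|⁻¹ * |(x 0 : ℝ)| ^ (-l) :=
      mul_le_mul_of_nonneg_left (Real.rpow_le_rpow_of_nonpos hx0 hx.2.1 (by linarith))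
        (inv_nonneg.2 hx0.le)
    _ = |(x 0 : ℝ)| ^ (-(l + 1)) := by
      rw [← Real.rpow_neg_one, ← Real.rpow_add hx0]
      ring_nf
    _ ≤ ((r.den : ℝ) ^ n) ^ (-(l + 1)) :=
      Real.rpow_le_rpow_of_nonpos (by positivity) hden (by linarith)
    _ = (r.den : ℝ) ^ (-(n * (l + 1))) := by
      rw [← Real.rpow_natCast, ← Real.rpow_mul hrden.le]
      ring_nf

lemma IsAdmissible.liouvilleWith (h : IsAdmissible n ξ l) (hn : 1 ≤ n) (hξ : Irrational ξ)
    (hl : 1 < l) : LiouvilleWith (n * (l + 1)) ξ := by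
  refine liouvilleWith_of_forall_exists_rat (C := 2) fun Q => ?_
  obtain ⟨ε, hε, hεpos⟩ := (((hξ.eventually_forall_le_dist_cast_rat_of_den_le Q).filter_mono
    (nhdsWithin_le_nhds (s := Ioi (0 : ℝ)))).and self_mem_nhdsWithin).exists
  have hsmall : ∀ᶠ X : ℝ in atTop, X ^ (-l) < ε :=
    (tendsto_rpow_neg_atTop (by linarith)).eventually_lt_const hεpos
  obtain ⟨X, ⟨x, hx⟩, hrat, hXε⟩ :=
    (h.and_eventually ((eventually_exists_rat_of_isSolution hn ξ hl).and hsmall)).exists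
  obtain ⟨r, hrX, hrden⟩ := hrat x hx
  have hpos := den_pos r
  refine ⟨r, ?_, hξ.ne_rat r, hrden.trans_lt ?_⟩
  · by_contra! hQ
    exact (hε r hQ.le).not_gt (hrX.trans_lt hXε)
  · rw [Real.rpow_neg hpos.le, ← one_div]
    gcongr
    norm_num

lemma HasIrrationalityExponent.lambdaExp_eq (hn : 1 ≤ n) (hl : 1 ≤ l)
    (h : HasIrrationalityExponent ξ (n * (l + 1))) : lambdaExp n ξ = l := by
  have hnR : (1 : ℝ) ≤ n := by exact_mod_cast hn
  have hone : 1 < n * (l + 1) := by nlinarith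
  refine le_antisymm ?_ (EReal.ge_of_forall_gt_iff_ge.1 fun l' hl' => ?_)
  · have hξ : Irrational ξ := by
      obtain ⟨p, hp, hp1⟩ := (lt_isLUB_iff h).1 hone
      exact hp.irrational hp1
    rw [lambdaExp_eq_sSup]
    refine sSup_le ?_
    rintro _ ⟨l', hadm, rfl⟩
    refine EReal.coe_le_coe_iff.2 (le_of_not_gt fun hlt => ?_)
    have hle := h.1 (IsAdmissible.liouvilleWith hadm hn hξ (hl.trans_lt hlt))
    nlinarith
  · have hl'l : l' < l := by exact_mod_cast hl'
    obtain ⟨p, hp, hp'⟩ := (lt_isLUB_iff h).1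
      (max_lt (by nlinarith : n * (l' + 1) < n * (l + 1)) hone)
    exact (isAdmissible_of_liouvilleWith hn (by linarith [le_max_right (n * (l' + 1)) (1 : ℝ)])
      ((le_max_left _ _).trans_lt hp') hp).coe_le_lambdaExp

lemma lambdaExp_eq_top_of_liouville (hn : 1 ≤ n) (hξ : Liouville ξ) : lambdaExp n ξ = ⊤ := by
  refine eq_top_iff.2 (EReal.ge_of_forall_gt_iff_ge.1 fun l _ => ?_)
  have hp : max (n * (l + 1)) 0 < max (n * (l + 1)) 0 + 1 := lt_add_one _
  exact (isAdmissible_of_liouvilleWith hn ((le_max_right _ _).trans_lt hp)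
    ((le_max_left _ _).trans_lt hp) (hξ.liouvilleWith _)).coe_le_lambdaExp

end Exponent

section Construction

/-- The interval to the right of `r` in which the construction keeps all later approximations once
`r` has been chosen. -/
def rightCell (r : ℚ) : Set ℝ := Icc r (r + 1 / (r.den : ℝ) ^ 2)

/-- One step of the construction of a number of irrationality exponent `c`: `r < r'` are
neighbours in a Farey sequence, and the denominators grow like `q ↦ q ^ (c - 1)`, so that `r' - r`
has the order of magnitude `q ^ (-c)`. -/
structure IsFareyStep (c : ℝ) (r r' : ℚ) : Prop where
  sub_eq : (r' : ℝ) - r = 1 / (r.den * r'.den)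
  le_den : 2 * (r.den : ℝ) ^ (c - 1) ≤ r'.den
  den_le : (r'.den : ℝ) ≤ 5 * (r.den : ℝ) ^ (c - 1)

lemma exists_rat_sub_eq_one_div_den_mul_den (r : ℚ) {T : ℝ} (hT : 0 < T) :
    ∃ r' : ℚ, (r' : ℝ) - r = 1 / (r.den * r'.den) ∧ T ≤ r'.den ∧ (r'.den : ℝ) < T + r.den := by
  obtain ⟨u, v, huv⟩ := r.isCoprime_num_den
  obtain ⟨j, ⟨hjT, hjT'⟩, -⟩ := existsUnique_add_zsmul_mem_Ico (den_pos r) (-u : ℝ) T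
  set t : ℤ := -u + j * r.den with ht
  set s : ℤ := v + j * r.num with hs
  have hdet : s * r.den - r.num * t = 1 := by rw [ht, hs, ← huv]; ring
  have htR : (t : ℝ) = -u + j • (r.den : ℝ) := by rw [ht, zsmul_eq_mul]; push_cast; ring
  rw [← htR] at hjT hjT'
  have ht0 : 0 < t := by exact_mod_cast hT.trans_le hjT
  have hcop : Nat.Coprime s.natAbs t.natAbs :=
    Int.isCoprime_iff_nat_coprime.1 ⟨r.den, -r.num, by rw [← hdet]; ring⟩
  have hden : (((s / t : ℚ).den : ℤ) : ℝ) = t := by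
    exact_mod_cast Rat.den_div_eq_of_coprime ht0 hcop
  rw [Int.cast_natCast] at hden
  refine ⟨s / t, ?_, by rwa [hden], by rwa [hden]⟩
  have hr0 := (den_pos r).ne'
  have htR0 : (t : ℝ) ≠ 0 := by exact_mod_cast ht0.ne'
  have hdetR : (s : ℝ) * r.den - r.num * t = 1 := by exact_mod_cast hdet
  rw [hden, Rat.cast_def r]
  push_cast
  rw [div_sub_div _ _ htR0 hr0, mul_comm (t : ℝ) r.num, hdetR, mul_comm (t : ℝ)]

lemma disjoint_rightCell {r r₁ r₂ : ℚ} (h₁ : (r₁ : ℝ) - r = 1 / (r.den * r₁.den))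
    (h₂ : (r₂ : ℝ) - r = 1 / (r.den * r₂.den)) (hden : (r₁.den + r.den : ℝ) ≤ r₂.den) :
    Disjoint (rightCell r₁) (rightCell r₂) := by
  have hr := den_pos r
  have hlt_den : r₁.den < r₂.den := by
    exact_mod_cast (by linarith : (r₁.den : ℝ) < r₂.den)
  have hlt : (r₂ : ℝ) + 1 / (r₂.den : ℝ) ^ 2 < r₁ := by
    have hgap : 1 / (r₂.den : ℝ) ^ 2 < 1 / (r.den * r₁.den) - 1 / (r.den * r₂.den) := by
      have hsub : 1 / (r.den * r₁.den) - 1 / (r.den * r₂.den) =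
          ((r₂.den - r₁.den) / (r.den * r₁.den * r₂.den) : ℝ) := by
        field_simp
      rw [hsub, div_lt_div_iff₀ (by positivity) (by positivity)]
      calc 1 * ((r.den : ℝ) * r₁.den * r₂.den) < r.den * r₂.den * r₂.den := by
            rw [one_mul]
            gcongr
        _ ≤ (r₂.den - r₁.den) * r₂.den * r₂.den := by gcongr; linarith
        _ = (r₂.den - r₁.den) * (r₂.den : ℝ) ^ 2 := by ring
    linarith
  exact disjoint_left.2 fun x hx₁ hx₂ => (hx₂.2.trans_lt hlt).not_ge hx₁.1

variable {c : ℝ}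

lemma den_le_den_rpow (hc : 2 ≤ c) (r : ℚ) : (r.den : ℝ) ≤ (r.den : ℝ) ^ (c - 1) :=
  Real.self_le_rpow_of_one_le (one_le_den r) (by linarith)

lemma den_mul_den_rpow (c : ℝ) (r : ℚ) : (r.den : ℝ) * (r.den : ℝ) ^ (c - 1) = (r.den : ℝ) ^ c := by
  rw [Real.rpow_sub_one (den_pos r).ne', mul_div_cancel₀ _ (den_pos r).ne']

lemma exists_isFareyStep_notMem_rightCell (hc : 2 ≤ c) (r : ℚ) (α : ℝ) :
    ∃ r', IsFareyStep c r r' ∧ α ∉ rightCell r' := by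
  have hgrow := den_le_den_rpow hc r
  have hr := den_pos r
  obtain ⟨r₁, h₁, hT₁, hT₁'⟩ := exists_rat_sub_eq_one_div_den_mul_den r
    (show 0 < 2 * (r.den : ℝ) ^ (c - 1) by positivity)
  obtain ⟨r₂, h₂, hT₂, hT₂'⟩ := exists_rat_sub_eq_one_div_den_mul_den r
    (show (0 : ℝ) < r₁.den + r.den by positivity)
  by_cases hα : α ∈ rightCell r₁
  · exact ⟨r₂, ⟨h₂, by linarith, by linarith⟩,
      disjoint_left.1 (disjoint_rightCell h₁ h₂ hT₂) hα⟩
  · exact ⟨r₁, ⟨h₁, hT₁, by linarith⟩, hα⟩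

lemma exists_seq_isFareyStep (hc : 2 ≤ c) (α : ℕ → ℝ) :
    ∃ r : ℕ → ℚ, r 0 = 0 ∧ ∀ k, IsFareyStep c (r k) (r (k + 1)) ∧ α k ∉ rightCell (r (k + 1)) := by
  choose next hnext using exists_isFareyStep_notMem_rightCell hc
  exact ⟨fun k => Nat.rec 0 (fun k r => next r (α k)) k, rfl, fun k => hnext _ _⟩

namespace IsFareyStep

variable {r r' : ℚ}

lemma two_mul_den_le (h : IsFareyStep c r r') (hc : 2 ≤ c) : 2 * (r.den : ℝ) ≤ r'.den := by
  linarith [h.le_den, den_le_den_rpow hc r]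

lemma one_div_le_sub (h : IsFareyStep c r r') {x : ℝ} (hx : x ∈ rightCell r') :
    1 / (r.den * r'.den : ℝ) ≤ x - r := by
  linarith [h.sub_eq, hx.1]

lemma sub_le_two_div (h : IsFareyStep c r r') (hc : 2 ≤ c) {x : ℝ} (hx : x ∈ rightCell r') :
    x - r ≤ 2 / (r.den * r'.den) := by
  have hr' := den_pos r'
  have hden : r.den ≤ r'.den := by
    exact_mod_cast (by linarith [h.two_mul_den_le hc] : (r.den : ℝ) ≤ r'.den)
  have hle : 1 / (r'.den : ℝ) ^ 2 ≤ 1 / (r.den * r'.den) := by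
    rw [sq]
    gcongr
  calc x - r ≤ 1 / (r.den * r'.den) + 1 / (r'.den : ℝ) ^ 2 := by linarith [h.sub_eq, hx.2]
    _ ≤ 1 / (r.den * r'.den) + 1 / (r.den * r'.den) := by gcongr
    _ = 2 / (r.den * r'.den) := by ring

lemma rightCell_subset (h : IsFareyStep c r r') (hc : 2 ≤ c) : rightCell r' ⊆ rightCell r := by
  intro x hx
  have hlow : 0 ≤ x - r := le_trans (by positivity) (h.one_div_le_sub hx)
  have hup : x - r ≤ 1 / (r.den : ℝ) ^ 2 :=
    calc x - r ≤ 2 / (r.den * r'.den) := h.sub_le_two_div hc hx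
      _ ≤ 2 / (r.den * (2 * r.den)) := by gcongr; exact h.two_mul_den_le hc
      _ = 1 / (r.den : ℝ) ^ 2 := by field_simp
  exact ⟨by linarith, by linarith⟩

lemma sub_le_one_div_rpow (h : IsFareyStep c r r') (hc : 2 ≤ c) {x : ℝ} (hx : x ∈ rightCell r') :
    x - r ≤ 1 / (r.den : ℝ) ^ c := by
  calc x - r ≤ 2 / (r.den * r'.den) := h.sub_le_two_div hc hx
    _ ≤ 2 / (r.den * (2 * (r.den : ℝ) ^ (c - 1))) := by gcongr; exact h.le_den
    _ = 1 / (r.den * (r.den : ℝ) ^ (c - 1)) := by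
      rw [mul_left_comm, ← div_div, div_self two_ne_zero]
    _ = 1 / (r.den : ℝ) ^ c := by rw [den_mul_den_rpow]

lemma one_div_rpow_le_sub (h : IsFareyStep c r r') {x : ℝ} (hx : x ∈ rightCell r') :
    1 / (5 * (r.den : ℝ) ^ c) ≤ x - r := by
  calc 1 / (5 * (r.den : ℝ) ^ c) = 1 / (r.den * (5 * (r.den : ℝ) ^ (c - 1))) := by
        rw [← den_mul_den_rpow]; ring_nf
    _ ≤ 1 / (r.den * r'.den) := by gcongr; exact h.den_le
    _ ≤ x - r := h.one_div_le_sub hx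

lemma one_div_sq_le_abs_sub (h : IsFareyStep c r r') (hc : 2 ≤ c) {x : ℝ} (hx : x ∈ rightCell r')
    {s : ℚ} (hs : s ≠ r) (hlow : (r.den : ℝ) < 4 * s.den) (hup : 4 * (s.den : ℝ) ≤ r'.den) :
    1 / (8 * (s.den : ℝ) ^ 2) ≤ |x - s| := by
  have hsr : 1 / (s.den * r.den : ℝ) ≤ |(s : ℝ) - r| := by
    have h := (Rat.cast_le (K := ℝ)).2 (one_div_den_mul_den_le_abs_sub hs)
    push_cast at h
    exact h
  have hxr : |x - r| ≤ 1 / (2 * (s.den * r.den)) := by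
    rw [abs_of_nonneg (le_trans (by positivity) (h.one_div_le_sub hx))]
    calc x - r ≤ 2 / (r.den * r'.den) := h.sub_le_two_div hc hx
      _ ≤ 2 / (r.den * (4 * s.den)) := by gcongr
      _ = 1 / (2 * (s.den * r.den)) := by field_simp; norm_num
  have htri : |(s : ℝ) - r| ≤ |x - s| + |x - r| := by
    rw [abs_sub_comm x s]
    exact abs_sub_le _ _ _
  calc 1 / (8 * (s.den : ℝ) ^ 2) = 1 / (2 * (s.den * (4 * s.den))) := by ring_nf
    _ ≤ 1 / (2 * (s.den * r.den)) := by gcongr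
    _ = 1 / (s.den * r.den) - 1 / (2 * (s.den * r.den)) := by field_simp; norm_num
    _ ≤ |x - s| := by linarith

end IsFareyStep

section Limit

variable {r : ℕ → ℚ} {x : ℝ}

lemma exists_forall_mem_rightCell (hc : 2 ≤ c) (h : ∀ k, IsFareyStep c (r k) (r (k + 1))) :
    ∃ x, ∀ k, x ∈ rightCell (r k) := by
  have hanti : Antitone fun k => rightCell (r k) :=
    antitone_nat_of_succ_le fun k => (h k).rightCell_subset hc
  exact ⟨_, mem_iInter.1 (ciSup_mem_iInter_Icc_of_antitone_Icc hanti
    fun k => le_add_of_nonneg_right (by positivity))⟩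

lemma strictMono_den (hc : 2 ≤ c) (h : ∀ k, IsFareyStep c (r k) (r (k + 1))) :
    StrictMono fun k => (r k).den :=
  strictMono_nat_of_lt_succ fun k => by
    have hle := (h k).two_mul_den_le hc
    have hpos := den_pos (r k)
    exact_mod_cast (by linarith : ((r k).den : ℝ) < (r (k + 1)).den)

lemma liouvilleWith_of_isFareyStep (hc : 2 ≤ c) (h : ∀ k, IsFareyStep c (r k) (r (k + 1)))
    (hx : ∀ k, x ∈ rightCell (r k)) : LiouvilleWith c x := by
  refine liouvilleWith_of_forall_exists_rat (C := 2) fun Q =>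
    ⟨r Q, (strictMono_den hc h).le_apply, ?_, ?_⟩
  · have hlow : 0 < x - r Q := lt_of_lt_of_le (by positivity) ((h Q).one_div_rpow_le_sub (hx _))
    exact (sub_pos.1 hlow).ne'
  · rw [abs_of_nonneg (sub_nonneg.2 (hx Q).1)]
    refine ((h Q).sub_le_one_div_rpow hc (hx _)).trans_lt ?_
    gcongr
    norm_num

lemma div_rpow_le_abs_sub_of_isFareyStep (hc : 2 ≤ c) (h0 : r 0 = 0)
    (h : ∀ k, IsFareyStep c (r k) (r (k + 1))) (hx : ∀ k, x ∈ rightCell (r k)) (s : ℚ) :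
    1 / (5 * 4 ^ c) / (s.den : ℝ) ^ c ≤ |x - s| := by
  have hs1 := one_le_den s
  have hstart : (r 0).den < 4 * s.den := by
    rw [h0, Rat.den_zero]
    linarith [s.pos]
  obtain ⟨k, hlow, hup⟩ :=
    (strictMono_den hc h).exists_between_of_tendsto_atTop (strictMono_den hc h).tendsto_atTop hstart
  have hlowR : ((r k).den : ℝ) < 4 * s.den := by exact_mod_cast hlow
  have hupR : 4 * (s.den : ℝ) ≤ (r (k + 1)).den := by exact_mod_cast hup
  by_cases hs : s = r k
  · calc 1 / (5 * 4 ^ c) / (s.den : ℝ) ^ c = 1 / (5 * (4 * (s.den : ℝ)) ^ c) := by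
          rw [Real.mul_rpow (by norm_num) (by positivity), div_div, mul_assoc]
      _ ≤ 1 / (5 * ((r k).den : ℝ) ^ c) := by gcongr
      _ ≤ x - r k := (h k).one_div_rpow_le_sub (hx _)
      _ ≤ |x - s| := by rw [hs]; exact le_abs_self _
  · have hfour : (8 : ℝ) ≤ 5 * 4 ^ c := by
      have := Real.self_le_rpow_of_one_le (by norm_num : (1 : ℝ) ≤ 4) (by linarith : 1 ≤ c)
      linarith
    have hpow : (s.den : ℝ) ^ 2 ≤ (s.den : ℝ) ^ c := by
      exact_mod_cast Real.rpow_le_rpow_of_exponent_le hs1 hc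
    calc 1 / (5 * 4 ^ c) / (s.den : ℝ) ^ c ≤ 1 / 8 / (s.den : ℝ) ^ 2 := by gcongr
      _ = 1 / (8 * (s.den : ℝ) ^ 2) := div_div _ _ _
      _ ≤ |x - s| := (h k).one_div_sq_le_abs_sub hc (hx _) hs hlowR hupR

lemma hasIrrationalityExponent_of_isFareyStep (hc : 2 ≤ c) (h0 : r 0 = 0)
    (h : ∀ k, IsFareyStep c (r k) (r (k + 1))) (hx : ∀ k, x ∈ rightCell (r k)) :
    HasIrrationalityExponent x c := by
  refine IsGreatest.isLUB ⟨liouvilleWith_of_isFareyStep hc h hx, fun s hs => ?_⟩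
  by_contra! hcs
  exact not_liouvilleWith_of_forall_div_rpow_le (by linarith) (by positivity)
    (div_rpow_le_abs_sub_of_isFareyStep hc h0 h hx) hcs hs

end Limit

theorem exists_notMem_hasIrrationalityExponent {A : Set ℝ} (hA : A.Countable) (hc : 2 ≤ c) :
    ∃ x ∉ A, HasIrrationalityExponent x c := by
  obtain ⟨α, hα⟩ := countable_iff_exists_subset_range.1 hA
  obtain ⟨r, h0, hr⟩ := exists_seq_isFareyStep hc α
  obtain ⟨x, hx⟩ := exists_forall_mem_rightCell hc fun k => (hr k).1
  refine ⟨x, fun hxA => ?_,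
    hasIrrationalityExponent_of_isFareyStep hc h0 (fun k => (hr k).1) hx⟩
  obtain ⟨k, rfl⟩ := hα hxA
  exact (hr k).2 (hx (k + 1))

end Construction

end SimultApprox

open SimultApprox in
theorem theorem10_general (n : ℕ) (hn : 1 ≤ n) : Icc 1 ⊤ ⊆ lambdaSpectrum n := by
  rintro L ⟨hL, -⟩
  have hnR : (1 : ℝ) ≤ n := by exact_mod_cast hn
  induction L with
  | bot => exact absurd (le_bot_iff.1 hL) (EReal.coe_ne_bot 1)
  | top =>
    have hξ := liouville_liouvilleNumber (m := 2) le_rfl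
    exact ⟨_, (IsFractionRing.isAlgebraic_iff ℤ ℚ ℝ).not.1 hξ.transcendental,
      lambdaExp_eq_top_of_liouville hn hξ⟩
  | coe l =>
    have hl : 1 ≤ l := by exact_mod_cast hL
    obtain ⟨ξ, hξ, hexp⟩ := exists_notMem_hasIrrationalityExponent
      (Algebraic.countable ℚ ℝ) (by nlinarith : 2 ≤ n * (l + 1))
    exact ⟨ξ, hξ, hexp.lambdaExp_eq hn hl⟩

theorem theorem10 (n : ℕ) (hn : 1 ≤ n) :
    Set.Ioc (((3 + Real.sqrt (4 * (n : ℝ) ^ 2 + 1)) / (2 * (n : ℝ)) : ℝ) : EReal) ⊤ ⊆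
      SimultApprox.lambdaSpectrum n := by
  have hnR : (1 : ℝ) ≤ n := by exact_mod_cast hn
  have hsqrt : 2 * (n : ℝ) ≤ √(4 * (n : ℝ) ^ 2 + 1) := Real.le_sqrt_of_sq_le (by linarith)
  have hone : 1 ≤ (3 + √(4 * (n : ℝ) ^ 2 + 1)) / (2 * n) := by
    rw [le_div_iff₀ (by linarith)]
    linarith
  exact (Ioc_subset_Icc_self.trans (Icc_subset_Icc_left (by exact_mod_cast hone))).trans
    (theorem10_general n hn)
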